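/- Let $\mathbf{Quant}_{\mathrm{mixed}}$ be the category whose objects are finite-dimensional complex Hilbert spaces $\mathcal H$ (the zero space included) and whose morphisms $\mathcal H\to\mathcal H'$ are the completely positive linear maps $f\colon\mathcal B(\mathcal H)\to\mathcal B(\mathcal H')$, i.e. those with $(f\otimes\mathrm{id}_{\mathcal K})(\mathcal B(\mathcal H\otimes\mathcal K)^+)\subseteq\mathcal B(\mathcal H'\otimes\mathcal K)^+$ for every finite-dimensional Hilbert space $\mathcal K$. It is enriched in commutative monoids by the addition of linear maps, and it has discarding morphisms $\mathrm{tr}_{\mathcal H}\colon\mathcal H\to I$, where $I=\mathbb C$. A morphism $f\colon\mathcal H\to\mathcal H'$ is called causal if $\mathrm{tr}_{\mathcal H'}\circ f=\mathrm{tr}_{\mathcal H}$, i.e. if it is trace-preserving. Proposition. $\mathbf{Quant}_{\mathrm{mixed}}$ has the (causal) finite decomposition property. That is, it has causal disjoint embeddings (1), and every causal idempotent in it has a causal finite decomposition (2): 1. For every finite (possibly empty) family $\mathcal H_1,\dots,\mathcal H_n$ of objects there are an object $\mathcal H$ and morphisms $\kappa_i\colon\mathcal H_i\to\mathcal H$,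 $\pi_i\colon\mathcal H\to\mathcal H_i$ with $\pi_i\circ\kappa_i=\mathrm{id}$ for all $i$ and $\pi_i\circ\kappa_j=0$ for $i\ne j$, such that every $\kappa_i$ and the sum $\sum_{i=1}^n\kappa_i\circ\pi_i$ are causal. 2. For every object $\mathcal H$ and every causal morphism $p\colon\mathcal H\to\mathcal H$ with $p\circ p=p$ there are $n\ge 0$, objects $\mathcal H_1,\dots,\mathcal H_n$ and morphisms $e_i\colon\mathcal H\to\mathcal H_i$, $m_i\colon\mathcal H_i\to\mathcal H$ with every $m_i$ causal, such that $$p=\sum_{i=1}^n m_i\circ e_i,\qquad e_i\circ m_i=\mathrm{id}_{\mathcal H_i}\ \text{ for all } i,\qquad (m_i\circ e_i)\circ(m_j\circ e_j)=0\ \text{ for } i\neq j.$$ -/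

import Mathlib

universe v u

open CategoryTheory

open scoped TensorProduct

namespace CausalCat

section General

/-- A category with discarding: a chosen object `I` together with a family of effects
`discard A : A ⟶ I` such that `discard I` is the identity. -/
class CategoryWithDiscarding (C : Type u) [Category.{v} C] where
  /-- the chosen object representing "nothing" -/
  I : C
  /-- the discarding effects -/
  discard (A : C) : A ⟶ I
  discard_I : discard I = 𝟙 I

/-- A semi-additive category: a category enriched in commutative monoids. -/
class SemiAdditive (C : Type u) [Category.{v} C] where
  homMonoid (A B : C) : AddCommMonoid (A ⟶ B)
  add_comp {A B D : C} (f g : A ⟶ B) (h : B ⟶ D) : (f + g) ≫ h = f ≫ h + g ≫ h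
  comp_add {A B D : C} (f : A ⟶ B) (g h : B ⟶ D) : f ≫ (g + h) = f ≫ g + f ≫ h
  zero_comp {A B D : C} (h : B ⟶ D) : (0 : A ⟶ B) ≫ h = 0
  comp_zero {A B D : C} (f : A ⟶ B) : f ≫ (0 : B ⟶ D) = 0

attribute [reducible, instance] SemiAdditive.homMonoid

variable {C : Type u} [Category.{v} C]

/-- A morphism is causal when discarding its output is discarding its input. -/
def IsCausal [CategoryWithDiscarding C] {A B : C} (f : A ⟶ B) : Prop :=
  f ≫ CategoryWithDiscarding.discard B = CategoryWithDiscarding.discard A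

/-- `p : A ⟶ A` is idempotent. -/
def IsIdempotent {A : C} (p : A ⟶ A) : Prop :=
  p ≫ p = p

/-- A causal disjoint embedding of a finite family of objects `A i` into an object `X`. -/
structure CausalDisjointEmbedding [SemiAdditive C] [CategoryWithDiscarding C]
    {n : ℕ} (A : Fin n → C) where
  X : C
  κ (i : Fin n) : A i ⟶ X
  π (i : Fin n) : X ⟶ A i
  κ_π_self (i : Fin n) : κ i ≫ π i = 𝟙 (A i)
  κ_π_ne (i j : Fin n) : i ≠ j → κ j ≫ π i = 0
  causal_κ (i : Fin n) : IsCausal (κ i)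
  causal_sum : IsCausal (∑ i, π i ≫ κ i)

/-- A causal finite decomposition of an endomorphism `p`: it is a finite sum `p = ∑ mᵢ ∘ eᵢ` of
split idempotents (`mᵢ ∘ eᵢ` with `eᵢ ∘ mᵢ = id`), pairwise orthogonal, with every `mᵢ` causal. -/
structure CausalFiniteDecomposition [SemiAdditive C] [CategoryWithDiscarding C]
    {A : C} (p : A ⟶ A) where
  n : ℕ
  B (i : Fin n) : C
  e (i : Fin n) : A ⟶ B i
  m (i : Fin n) : B i ⟶ A
  m_e (i : Fin n) : m i ≫ e i = 𝟙 (B i)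
  orthogonal (i j : Fin n) : i ≠ j → (e j ≫ m j) ≫ (e i ≫ m i) = 0
  causal_m (i : Fin n) : IsCausal (m i)
  sum_eq : p = ∑ i, e i ≫ m i

variable (C) [SemiAdditive C] [CategoryWithDiscarding C]

/-- Every finite (possibly empty) family of objects has a causal disjoint embedding. -/
def HasCausalDisjointEmbeddings : Prop :=
  ∀ (n : ℕ) (A : Fin n → C), Nonempty (CausalDisjointEmbedding A)

/-- The finite decomposition property of a semi-additive category with discarding: it has causal
disjoint embeddings (the setting in which the property is considered), and every causal idempotent
has a causal finite decomposition. -/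
def HasFiniteDecompositionProperty : Prop :=
  HasCausalDisjointEmbeddings C ∧
    ∀ (A : C) (p : A ⟶ A), IsIdempotent p → IsCausal p → Nonempty (CausalFiniteDecomposition p)

end General

section CompletelyPositive

variable {H H' H'' K : Type*}
  [NormedAddCommGroup H] [InnerProductSpace ℂ H] [FiniteDimensional ℂ H]
  [NormedAddCommGroup H'] [InnerProductSpace ℂ H'] [FiniteDimensional ℂ H']
  [NormedAddCommGroup H''] [InnerProductSpace ℂ H''] [FiniteDimensional ℂ H'']
  [NormedAddCommGroup K] [InnerProductSpace ℂ K] [FiniteDimensional ℂ K]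

/-- The map `f ⊗ id_K : B(H ⊗ K) → B(H' ⊗ K)` for a linear map `f : B(H) → B(H')`, through the
canonical isomorphism `B(H) ⊗ B(K) ≅ B(H ⊗ K)`. -/
noncomputable def ampliation (K : Type*)
    [NormedAddCommGroup K] [InnerProductSpace ℂ K] [FiniteDimensional ℂ K]
    (f : (H →ₗ[ℂ] H) →ₗ[ℂ] (H' →ₗ[ℂ] H')) :
    (H ⊗[ℂ] K →ₗ[ℂ] H ⊗[ℂ] K) →ₗ[ℂ] (H' ⊗[ℂ] K →ₗ[ℂ] H' ⊗[ℂ] K) :=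
  (homTensorHomEquiv ℂ H' K H' K).toLinearMap ∘ₗ
    TensorProduct.map f LinearMap.id ∘ₗ
      (homTensorHomEquiv ℂ H K H K).symm.toLinearMap

theorem ampliation_map (f : (H →ₗ[ℂ] H) →ₗ[ℂ] (H' →ₗ[ℂ] H')) (S : H →ₗ[ℂ] H) (T : K →ₗ[ℂ] K) :
    ampliation K f (TensorProduct.map S T) = TensorProduct.map (f S) T := by
  have h : (homTensorHomEquiv ℂ H K H K).symm (TensorProduct.map S T) = S ⊗ₜ T := by
    rw [LinearEquiv.symm_apply_eq]; simp
  simp [ampliation, h]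

theorem ampliation_id :
    ampliation K (LinearMap.id : (H →ₗ[ℂ] H) →ₗ[ℂ] (H →ₗ[ℂ] H)) = LinearMap.id := by
  ext1 X
  simp only [ampliation, TensorProduct.map_id, LinearMap.id_comp, LinearMap.comp_apply,
    LinearEquiv.coe_coe, LinearEquiv.apply_symm_apply, LinearMap.id_apply]

theorem ampliation_comp (g : (H' →ₗ[ℂ] H') →ₗ[ℂ] (H'' →ₗ[ℂ] H''))
    (f : (H →ₗ[ℂ] H) →ₗ[ℂ] (H' →ₗ[ℂ] H')) :
    ampliation K (g ∘ₗ f) = ampliation K g ∘ₗ ampliation K f := by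
  ext1 X
  have h : TensorProduct.map (g ∘ₗ f) (LinearMap.id : (K →ₗ[ℂ] K) →ₗ[ℂ] _) =
      TensorProduct.map g LinearMap.id ∘ₗ TensorProduct.map f LinearMap.id := by
    rw [← TensorProduct.map_comp, LinearMap.id_comp]
  simp only [ampliation, LinearMap.comp_apply, h, LinearEquiv.coe_coe, LinearEquiv.symm_apply_apply]

theorem ampliation_add (f g : (H →ₗ[ℂ] H) →ₗ[ℂ] (H' →ₗ[ℂ] H')) :
    ampliation K (f + g) = ampliation K f + ampliation K g := by
  simp only [ampliation, TensorProduct.map_add_left, LinearMap.add_comp, LinearMap.comp_add]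

theorem ampliation_zero :
    ampliation K (0 : (H →ₗ[ℂ] H) →ₗ[ℂ] (H' →ₗ[ℂ] H')) = 0 := by
  simp only [ampliation, TensorProduct.map_zero_left, LinearMap.zero_comp, LinearMap.comp_zero]

end CompletelyPositive

/-- The objects of mixed quantum theory: finite-dimensional complex Hilbert spaces (the zero space
included). -/
structure QuantMixed : Type (u + 1) where
  carrier : Type u
  [normed : NormedAddCommGroup carrier]
  [innerProduct : InnerProductSpace ℂ carrier]
  [finiteDimensional : FiniteDimensional ℂ carrier]

namespace QuantMixed

instance : CoeSort QuantMixed.{u} (Type u) := ⟨carrier⟩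

attribute [instance] normed innerProduct finiteDimensional

/-- The operators on a finite-dimensional Hilbert space (all of them are bounded). -/
abbrev Op (H : QuantMixed.{u}) : Type u := H →ₗ[ℂ] H

/-- Complete positivity: `(f ⊗ id_K)(B(H ⊗ K)⁺) ⊆ B(H' ⊗ K)⁺` for all objects `K`. -/
def IsCompletelyPositive {H H' : QuantMixed.{u}} (f : H.Op →ₗ[ℂ] H'.Op) : Prop :=
  ∀ (K : QuantMixed.{u}) (X : H ⊗[ℂ] K →ₗ[ℂ] H ⊗[ℂ] K), X.IsPositive →
    (ampliation K f X).IsPositive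

/-- The morphisms of mixed quantum theory: completely positive linear maps `B(H) → B(H')`. -/
@[ext]
structure Hom (H H' : QuantMixed.{u}) where
  toLinearMap : H.Op →ₗ[ℂ] H'.Op
  completelyPositive : IsCompletelyPositive toLinearMap

theorem IsCompletelyPositive.id (H : QuantMixed.{u}) :
    IsCompletelyPositive (LinearMap.id : H.Op →ₗ[ℂ] H.Op) := by
  intro K X hX; rwa [ampliation_id]

theorem IsCompletelyPositive.comp {H H' H'' : QuantMixed.{u}} {g : H'.Op →ₗ[ℂ] H''.Op}
    {f : H.Op →ₗ[ℂ] H'.Op} (hg : IsCompletelyPositive g) (hf : IsCompletelyPositive f) :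
    IsCompletelyPositive (g ∘ₗ f) := by
  intro K X hX; rw [ampliation_comp]; exact hg K _ (hf K X hX)

theorem IsCompletelyPositive.add {H H' : QuantMixed.{u}} {f g : H.Op →ₗ[ℂ] H'.Op}
    (hf : IsCompletelyPositive f) (hg : IsCompletelyPositive g) :
    IsCompletelyPositive (f + g) := by
  intro K X hX; rw [ampliation_add]; exact (hf K X hX).add (hg K X hX)

theorem IsCompletelyPositive.zero (H H' : QuantMixed.{u}) :
    IsCompletelyPositive (0 : H.Op →ₗ[ℂ] H'.Op) := by
  intro K X _; rw [ampliation_zero]; exact LinearMap.isPositive_zero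

theorem IsCompletelyPositive.sum {H H' : QuantMixed.{u}} {ι : Type*} (s : Finset ι)
    (f : ι → (H.Op →ₗ[ℂ] H'.Op)) (hf : ∀ i ∈ s, IsCompletelyPositive (f i)) :
    IsCompletelyPositive (∑ i ∈ s, f i) :=
  Finset.sum_induction f IsCompletelyPositive (fun _ _ => .add) (.zero H H') hf

/-- The map `X ↦ V X V†`. -/
noncomputable def conj {H H' : QuantMixed.{u}} (V : H →ₗ[ℂ] H') : H.Op →ₗ[ℂ] H'.Op where
  toFun X := V ∘ₗ X ∘ₗ V.adjoint
  map_add' X Y := by simp [LinearMap.add_comp, LinearMap.comp_add]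
  map_smul' c X := by simp [LinearMap.smul_comp, LinearMap.comp_smul]

theorem IsCompletelyPositive.conj {H H' : QuantMixed.{u}} (V : H →ₗ[ℂ] H') :
    IsCompletelyPositive (QuantMixed.conj V) := by
  intro K X hX
  let W : H ⊗[ℂ] K →ₗ[ℂ] H' ⊗[ℂ] K := TensorProduct.map V LinearMap.id
  have hW : W.adjoint = TensorProduct.map V.adjoint LinearMap.id := by
    simp [W, TensorProduct.adjoint_map]
  have key : ampliation K (QuantMixed.conj V) X = W ∘ₗ X ∘ₗ W.adjoint := by
    obtain ⟨x, rfl⟩ := (homTensorHomEquiv ℂ H K H K).surjective X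
    clear hX
    induction x using TensorProduct.induction_on with
    | zero => simp
    | tmul S T =>
      have h : homTensorHomEquiv ℂ H K H K (S ⊗ₜ T) = TensorProduct.map S T := by simp
      rw [h, ampliation_map, hW, ← TensorProduct.map_comp, ← TensorProduct.map_comp]
      simp [QuantMixed.conj]
    | add x y hx hy =>
      rw [map_add, map_add, hx, hy, LinearMap.add_comp, LinearMap.comp_add]
  rw [key]
  exact hX.conj_adjoint W

instance (H H' : QuantMixed.{u}) : Zero (Hom H H') := ⟨⟨0, .zero H H'⟩⟩

instance (H H' : QuantMixed.{u}) : Add (Hom H H') :=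
  ⟨fun f g => ⟨f.toLinearMap + g.toLinearMap, f.completelyPositive.add g.completelyPositive⟩⟩

instance (H H' : QuantMixed.{u}) : AddCommMonoid (Hom H H') where
  nsmul := nsmulRec
  add_assoc f g h := Hom.ext (add_assoc f.toLinearMap g.toLinearMap h.toLinearMap)
  zero_add f := Hom.ext (zero_add f.toLinearMap)
  add_zero f := Hom.ext (add_zero f.toLinearMap)
  add_comm f g := Hom.ext (add_comm f.toLinearMap g.toLinearMap)

noncomputable instance : Category.{u} QuantMixed.{u} where
  Hom := Hom
  id H := ⟨LinearMap.id, .id H⟩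
  comp f g := ⟨g.toLinearMap ∘ₗ f.toLinearMap, g.completelyPositive.comp f.completelyPositive⟩

@[ext]
theorem hom_ext {H H' : QuantMixed.{u}} {f g : H ⟶ H'} (h : f.toLinearMap = g.toLinearMap) :
    f = g :=
  Hom.ext h

/-- The semi-additive structure: the usual addition of linear maps. -/
noncomputable instance : SemiAdditive QuantMixed.{u} where
  homMonoid H H' := inferInstanceAs (AddCommMonoid (Hom H H'))
  add_comp f g h := Hom.ext (LinearMap.comp_add f.toLinearMap g.toLinearMap h.toLinearMap)
  comp_add f g h := Hom.ext (LinearMap.add_comp f.toLinearMap h.toLinearMap g.toLinearMap)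
  zero_comp h := Hom.ext (LinearMap.comp_zero h.toLinearMap)
  comp_zero f := Hom.ext (LinearMap.zero_comp f.toLinearMap)

/-- The one-dimensional Hilbert space `ℂ` (as `ℂ¹`, so that it lives in every universe). -/
noncomputable def unit : QuantMixed.{u} where
  carrier := EuclideanSpace ℂ PUnit.{u + 1}

/-- The trace `B(H) → B(ℂ)`, where the number `c` is the operator `c • id` of `B(ℂ)`. -/
noncomputable def traceMap (H : QuantMixed.{u}) : H.Op →ₗ[ℂ] (unit.{u}).Op :=
  (LinearMap.trace ℂ H).smulRight LinearMap.id

theorem traceMap_apply (H : QuantMixed.{u}) (X : H.Op) :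
    traceMap H X = LinearMap.trace ℂ H X • LinearMap.id := rfl

theorem isCompletelyPositive_traceMap (H : QuantMixed.{u}) :
    IsCompletelyPositive (traceMap H) := by
  let b := stdOrthonormalBasis ℂ H
  let w : unit.{u} := EuclideanSpace.single PUnit.unit (1 : ℂ)
  let V (i : Fin (Module.finrank ℂ H)) : H →ₗ[ℂ] unit.{u} :=
    (innerₛₗ ℂ (b i)).smulRight w
  have hw : ∀ z : unit.{u}, (inner ℂ w z) • w = z := by
    have h : ∀ z : EuclideanSpace ℂ PUnit.{u + 1},
        inner ℂ (EuclideanSpace.single PUnit.unit (1 : ℂ)) z •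
          EuclideanSpace.single PUnit.unit (1 : ℂ) = z := by
      intro z
      apply PiLp.ext
      rintro ⟨⟩
      simp [EuclideanSpace.inner_single_left]
    exact h
  have hV : ∀ i z, (V i).adjoint z = inner ℂ w z • b i := by
    intro i z
    refine ext_inner_left ℂ fun x => ?_
    rw [LinearMap.adjoint_inner_right, inner_smul_right]
    simp [V, inner_smul_left, mul_comm]
  have key : traceMap H = ∑ i, QuantMixed.conj (V i) := by
    ext1 X
    ext1 z
    rw [traceMap_apply, LinearMap.trace_eq_sum_inner X b]
    simp only [LinearMap.smul_apply, LinearMap.id_apply, LinearMap.sum_apply, QuantMixed.conj,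
      LinearMap.coe_mk, AddHom.coe_mk, LinearMap.comp_apply, hV, map_smul, Finset.sum_smul]
    refine Finset.sum_congr rfl fun i _ => ?_
    conv_lhs => rw [← hw z]
    simp [V, smul_smul, mul_comm]
  rw [key]
  exact .sum _ _ fun i _ => .conj (V i)

/-- Discarding is the trace; hence the causal maps are the trace-preserving ones. -/
noncomputable instance : CategoryWithDiscarding QuantMixed.{u} where
  I := unit
  discard H := ⟨traceMap H, isCompletelyPositive_traceMap H⟩
  discard_I := by
    apply Hom.ext
    change traceMap unit.{u} = LinearMap.id
    have h1 : Module.finrank ℂ unit.{u} = 1 := by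
      change Module.finrank ℂ (EuclideanSpace ℂ PUnit.{u + 1}) = 1
      simp
    ext1 X
    obtain ⟨c, hc, -⟩ := LinearMap.existsUnique_eq_smul_id_of_finrank_eq_one h1 X
    rw [traceMap_apply, hc]
    simp [h1]

end QuantMixed

end CausalCat

/-!
Disjoint embeddings come from the orthogonal direct sum of Hilbert spaces, with the inclusions `ι i`
and their adjoints acting by conjugation.

For a causal idempotent `p` on `B(H)`, write `p X = ∑ Vᵢ X Vᵢ†` (Choi's theorem,
`IsCompletelyPositive.exists_eq_sum_conj`). The operator `p(1) = ∑ Vᵢ Vᵢ†` is fixed by `p`, and the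
`Vᵢ` take values in its range `U`; so `p` factors through `B(U)`, and the induced idempotent on
`B(U)` has a positive definite fixed point
(`nonempty_causalFiniteDecomposition_of_factor` transports a decomposition back).

With a faithful fixed state, the fixed points of the trace dual `q a = ∑ Vᵢ† a Vᵢ` are exactly the
operators commuting with all `Vᵢ` and `Vᵢ†` (`mem_centralizer_of_heisenberg_eq`). By complete
reducibility and Schur's lemma, this commutant has a resolution of the identity into minimal
projections (`exists_minimal_projections`), and partial isometries within the equivalence classes of
these form matrix units (`exists_matrix_units`). Hence the commutant is a product of matrix algebras
`B(D q)`, each embedded by a `*`-homomorphism `σ q` with explicit Kraus operators, and recovered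
by compression to a copy of `D q` inside `H` through an isometry `J q`
(`exists_commutant_blocks`). In the dual picture, `e q` is the trace dual of `σ q`, and `m q` is
conjugation by `J q` followed by `p`, which is visibly trace-preserving.
-/

namespace CausalCat

/-! ### Trace duality and the fixed points of a unital map in Kraus form -/

section Operators

variable {K : Type*} [NormedAddCommGroup K] [InnerProductSpace ℂ K] [FiniteDimensional ℂ K]

theorem eq_zero_of_forall_trace_mul_eq_zero {Y : Module.End ℂ K}
    (h : ∀ Z : Module.End ℂ K, LinearMap.trace ℂ K (Z * Y) = 0) : Y = 0 := by
  ext1 x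
  have h1 := h ((innerₛₗ ℂ (Y x)).smulRight x)
  have h2 : ((innerₛₗ ℂ (Y x)).smulRight x) * Y = (innerₛₗ ℂ (Y x) ∘ₗ Y).smulRight x := rfl
  rw [h2, LinearMap.trace_smulRight] at h1
  simpa using h1

theorem ext_trace_mul {Y Y' : Module.End ℂ K}
    (h : ∀ Z : Module.End ℂ K, LinearMap.trace ℂ K (Z * Y) = LinearMap.trace ℂ K (Z * Y')) :
    Y = Y' := by
  rw [← sub_eq_zero]
  refine eq_zero_of_forall_trace_mul_eq_zero fun Z => ?_
  rw [mul_sub, map_sub, h, sub_self]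

theorem star_mul_self_eq_zero_iff {D : Module.End ℂ K} : star D * D = 0 ↔ D = 0 := by
  refine ⟨fun h => ?_, fun h => by simp [h]⟩
  ext1 x
  have h1 : inner ℂ x ((star D * D) x) = 0 := by rw [h]; simp
  rw [Module.End.mul_apply, LinearMap.star_eq_adjoint, LinearMap.adjoint_inner_right] at h1
  simpa using h1

/-- A partial isometry absorbs its initial projection. -/
theorem mul_eq_self_of_star_mul_self {w g : Module.End ℂ K} (h : star w * w = g)
    (hg : g * g = g) : w * g = w := by
  have hs : star g = g := by rw [← h, star_mul, star_star]
  have h0 : star (w * g - w) * (w * g - w) = 0 := by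
    calc star (w * g - w) * (w * g - w)
        = star g * (star w * w) * g - star g * (star w * w) - star w * w * g + star w * w := by
          rw [star_sub, star_mul]; noncomm_ring
      _ = 0 := by rw [h, hs, hg, hg]; simp
  exact sub_eq_zero.1 (star_mul_self_eq_zero_iff.1 h0)

open scoped ComplexOrder in
/-- A finite sum of operators `Dᵢ ρ Dᵢ†` with `ρ` positive definite has trace zero only if every
`Dᵢ` vanishes. -/
theorem eq_zero_of_sum_trace_eq_zero {ι : Type*} [Fintype ι] {ρ : Module.End ℂ K}
    (hρ : LinearMap.IsPositive ρ) (hρ' : ∀ x, inner ℂ (ρ x) x = 0 → x = 0)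
    (D : ι → Module.End ℂ K)
    (h : ∑ i, LinearMap.trace ℂ K (D i * ρ * star (D i)) = 0) (i : ι) : D i = 0 := by
  have hpos : ∀ i, LinearMap.IsPositive (D i * ρ * star (D i)) := fun i => hρ.conj_adjoint (D i)
  have h1 := (Finset.sum_eq_zero_iff_of_nonneg fun i _ => (hpos i).trace_nonneg).1 h i
    (Finset.mem_univ i)
  let b := stdOrthonormalBasis ℂ K
  rw [LinearMap.trace_eq_sum_inner _ b] at h1
  have h2 := (Finset.sum_eq_zero_iff_of_nonneg
    fun j _ => (hpos i).inner_nonneg_right (b j)).1 h1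
  have h3 : star (D i) = 0 := by
    refine b.toBasis.ext fun j => ?_
    have h4 := h2 j (Finset.mem_univ j)
    rw [mul_assoc, Module.End.mul_apply, Module.End.mul_apply, ← LinearMap.adjoint_inner_left,
      ← LinearMap.star_eq_adjoint] at h4
    rw [OrthonormalBasis.coe_toBasis, LinearMap.zero_apply]
    apply hρ'
    rw [← inner_conj_symm, h4, map_zero]
  simpa using congrArg star h3

section Kraus

variable {ι : Type*} [Fintype ι] (V : ι → Module.End ℂ K)

/-- The adjoint `a ↦ ∑ Vᵢ† a Vᵢ`, for the trace pairing, of the map `X ↦ ∑ Vᵢ X Vᵢ†`. -/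
noncomputable def heisenberg (a : Module.End ℂ K) : Module.End ℂ K := ∑ i, star (V i) * a * V i

theorem trace_mul_sum_conj (a X : Module.End ℂ K) :
    LinearMap.trace ℂ K (a * ∑ i, V i * X * star (V i)) =
      LinearMap.trace ℂ K (heisenberg V a * X) := by
  rw [heisenberg, Finset.mul_sum, Finset.sum_mul, map_sum, map_sum]
  refine Finset.sum_congr rfl fun i _ => ?_
  rw [LinearMap.trace_mul_comm, mul_assoc, LinearMap.trace_mul_comm]
  simp only [mul_assoc]

variable {V}

theorem heisenberg_of_mem_centralizer (hV : ∑ i, star (V i) * V i = 1) {a : Module.End ℂ K}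
    (ha : a ∈ StarSubalgebra.centralizer ℂ (Set.range V)) : heisenberg V a = a := by
  have h (i : ι) : star (V i) * a * V i = star (V i) * V i * a := by
    rw [mul_assoc, mul_assoc,
      ((StarSubalgebra.mem_centralizer_iff ℂ).1 ha (V i) ⟨i, rfl⟩).1]
  rw [heisenberg, Finset.sum_congr rfl fun i _ => h i, ← Finset.sum_mul, hV, one_mul]

/-- The fixed points of a unital map `q a = ∑ Vᵢ† a Vᵢ` with a faithful invariant state commute with
the `Vᵢ`. With `Dᵢ = Vᵢ a - a Vᵢ` one has `∑ Dᵢ† Dᵢ = q(a†a) - a†a` for a fixed point `a`, and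
the right hand side has expectation zero in the invariant state. -/
theorem commute_of_heisenberg_eq {ρ : Module.End ℂ K}
    (hρ : LinearMap.IsPositive ρ) (hρ' : ∀ x, inner ℂ (ρ x) x = 0 → x = 0)
    (hfix : ∑ i, V i * ρ * star (V i) = ρ) (hV : ∑ i, star (V i) * V i = 1)
    {a : Module.End ℂ K} (ha : heisenberg V a = a) (i : ι) : V i * a = a * V i := by
  have hstar : ∑ i, star (V i) * star a * V i = star a := by
    conv_rhs => rw [← ha, heisenberg]
    simp [mul_assoc]
  have hD : ∑ i, star (V i * a - a * V i) * (V i * a - a * V i) =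
      heisenberg V (star a * a) - star a * a := by
    have h (i : ι) : star (V i * a - a * V i) * (V i * a - a * V i) =
        star a * (star (V i) * V i) * a - star a * (star (V i) * a * V i)
          - (star (V i) * star a * V i) * a + star (V i) * (star a * a) * V i := by
      simp only [star_sub, star_mul]; noncomm_ring
    rw [Finset.sum_congr rfl fun i _ => h i, Finset.sum_add_distrib, Finset.sum_sub_distrib,
      Finset.sum_sub_distrib, ← Finset.sum_mul, ← Finset.sum_mul, ← Finset.mul_sum,
      ← Finset.mul_sum, hV, hstar]
    have ha' : ∑ i, star (V i) * a * V i = a := ha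
    rw [ha', heisenberg, mul_one]
    abel
  have htr : LinearMap.trace ℂ K
      ((∑ i, star (V i * a - a * V i) * (V i * a - a * V i)) * ρ) = 0 := by
    rw [hD, sub_mul, map_sub, ← trace_mul_sum_conj, hfix, sub_self]
  rw [Finset.sum_mul, map_sum] at htr
  rw [← sub_eq_zero]
  refine eq_zero_of_sum_trace_eq_zero hρ hρ' (fun i => V i * a - a * V i) ?_ i
  rw [← htr]
  refine Finset.sum_congr rfl fun i _ => ?_
  rw [mul_assoc (star _), LinearMap.trace_mul_comm]

/-- The fixed points are closed under adjoints, so `commute_of_heisenberg_eq` also makes them commute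
with the `Vᵢ†`. -/
theorem mem_centralizer_of_heisenberg_eq {ρ : Module.End ℂ K}
    (hρ : LinearMap.IsPositive ρ) (hρ' : ∀ x, inner ℂ (ρ x) x = 0 → x = 0)
    (hfix : ∑ i, V i * ρ * star (V i) = ρ) (hV : ∑ i, star (V i) * V i = 1)
    {a : Module.End ℂ K} (ha : heisenberg V a = a) :
    a ∈ StarSubalgebra.centralizer ℂ (Set.range V) := by
  have ha' : heisenberg V (star a) = star a := by
    conv_rhs => rw [← ha, heisenberg]
    simp [heisenberg, mul_assoc]
  rw [StarSubalgebra.mem_centralizer_iff]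
  rintro _ ⟨i, rfl⟩
  refine ⟨commute_of_heisenberg_eq hρ hρ' hfix hV ha i, ?_⟩
  simpa using (congrArg star (commute_of_heisenberg_eq hρ hρ' hfix hV ha' i)).symm

end Kraus

end Operators

/-! ### Minimal projections of the commutant -/

section MinimalProjections

variable {K : Type u} [NormedAddCommGroup K] [InnerProductSpace ℂ K] [FiniteDimensional ℂ K]

/-- `L` is invariant under the operators in `S` and under their adjoints. -/
def IsReducing (S : Set (Module.End ℂ K)) (L : Submodule ℂ K) : Prop :=
  ∀ g ∈ S, (∀ x ∈ L, g x ∈ L) ∧ ∀ x ∈ L, star g x ∈ L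

variable {S : Set (Module.End ℂ K)}

theorem IsReducing.inf_orthogonal {L W : Submodule ℂ K} (hW : IsReducing S W)
    (hL : IsReducing S L) : IsReducing S (W ⊓ Lᗮ) := by
  refine fun g hg => ⟨fun x hx => ⟨(hW g hg).1 x hx.1, fun y hy => ?_⟩,
    fun x hx => ⟨(hW g hg).2 x hx.1, fun y hy => ?_⟩⟩
  · rw [← LinearMap.adjoint_inner_left, ← LinearMap.star_eq_adjoint]
    exact hx.2 _ ((hL g hg).2 y hy)
  · rw [LinearMap.star_eq_adjoint, LinearMap.adjoint_inner_right]
    exact hx.2 _ ((hL g hg).1 y hy)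

/-- Complete reducibility: a reducing subspace is a finite orthogonal sum of minimal ones. -/
theorem exists_orthogonal_minimal_reducing (W : Submodule ℂ K) (hW : IsReducing S W) :
    ∃ s : Finset (Submodule ℂ K),
      (∀ L ∈ s, Minimal (fun L => L ≠ ⊥ ∧ IsReducing S L) L) ∧
      (s : Set (Submodule ℂ K)).Pairwise (· ⟂ ·) ∧ s.sup id = W := by
  classical
  induction W using WellFoundedLT.induction with
  | ind W ih =>
    by_cases hbot : W = ⊥
    · exact ⟨∅, by simp, by simp, by simp [hbot]⟩
    · obtain ⟨L, hLW, hL⟩ := exists_minimal_le_of_wellFoundedLT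
        (fun L => L ≠ ⊥ ∧ IsReducing S L) W ⟨hbot, hW⟩
      have hlt : W ⊓ Lᗮ < W := by
        -- Otherwise `L ≤ W ≤ Lᗮ`, which forces `L = ⊥`.
        refine lt_of_le_of_ne inf_le_left fun h => hL.prop.1 ?_
        rw [eq_bot_iff, ← Submodule.inf_orthogonal_eq_bot L]
        exact le_inf le_rfl (hLW.trans (inf_eq_left.1 h))
      obtain ⟨s, hs, hs', hsup⟩ := ih _ hlt (hW.inf_orthogonal hL.prop.2)
      refine ⟨insert L s, ?_, ?_, ?_⟩
      · intro M hM
        rcases Finset.mem_insert.1 hM with rfl | hM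
        · exact hL
        · exact hs M hM
      · rw [Finset.coe_insert]
        have : Std.Symm (fun L M : Submodule ℂ K => L ⟂ M) := ⟨fun _ _ h => h.symm⟩
        refine hs'.insert_of_symm fun M hM _ => ?_
        have hle : M ≤ Lᗮ := (Finset.le_sup (f := id) hM).trans (hsup.le.trans inf_le_right)
        exact (Submodule.isOrtho_iff_le.2 hle).symm
      · rw [Finset.sup_insert, hsup, id]
        rw [inf_comm]
        exact Submodule.sup_orthogonal_inf_of_hasOrthogonalProjection hLW

theorem starProjection_mem_centralizer {L : Submodule ℂ K} (hL : IsReducing S L) :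
    (L.starProjection : Module.End ℂ K) ∈ StarSubalgebra.centralizer ℂ S := by
  have key : ∀ g : Module.End ℂ K, (∀ x ∈ L, g x ∈ L) → (∀ x ∈ L, star g x ∈ L) →
      g * (L.starProjection : Module.End ℂ K) = (L.starProjection : Module.End ℂ K) * g := by
    intro g h1 h2
    ext1 x
    refine (Submodule.eq_starProjection_of_mem_orthogonal (h1 _ ?_) fun y hy => ?_).symm
    · exact Submodule.starProjection_apply_mem _ _
    · change inner ℂ y (g x - g (L.starProjection x)) = 0
      rw [← map_sub, ← LinearMap.adjoint_inner_left, ← LinearMap.star_eq_adjoint]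
      exact Submodule.sub_starProjection_mem_orthogonal x _ (h2 y hy)
  rw [StarSubalgebra.mem_centralizer_iff]
  intro g hg
  exact ⟨key g (hL g hg).1 (hL g hg).2, key (star g) (hL g hg).2 (by simpa using (hL g hg).1)⟩

/-- Schur's lemma: an eigenspace in `L` of the compression of `a` to a minimal reducing subspace
`L` is reducing, hence all of `L`. -/
theorem exists_compression_eq_smul {L : Submodule ℂ K}
    (hL : Minimal (fun L => L ≠ ⊥ ∧ IsReducing S L) L) {a : Module.End ℂ K}
    (ha : a ∈ StarSubalgebra.centralizer ℂ S) :
    ∃ c : ℂ, (L.starProjection : Module.End ℂ K) * a * (L.starProjection : Module.End ℂ K) =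
      c • (L.starProjection : Module.End ℂ K) := by
  set f : Module.End ℂ K := (L.starProjection : K →ₗ[ℂ] K)
  have hfA : f ∈ StarSubalgebra.centralizer ℂ S := starProjection_mem_centralizer hL.prop.2
  have hfx : ∀ x, f x ∈ L := fun x => Submodule.starProjection_apply_mem _ _
  have hfL : ∀ x ∈ L, f x = x := fun x hx => Submodule.starProjection_eq_self_iff.2 hx
  have : Nontrivial L := Submodule.nontrivial_iff_ne_bot.2 hL.prop.1
  let t : Module.End ℂ L := (f * a).restrict (p := L) (q := L) fun x _ => hfx _
  obtain ⟨c, hc⟩ := Module.End.exists_eigenvalue t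
  obtain ⟨v, hv, hv0⟩ := hc.exists_hasEigenvector
  have hfa : f * a ∈ StarSubalgebra.centralizer ℂ S := mul_mem hfA ha
  -- The eigenspace, written as the kernel of an element of the commutant, is again reducing.
  have hM : IsReducing S (L ⊓ LinearMap.ker (f * a - c • 1)) := by
    intro g hg
    have hcomm := (StarSubalgebra.mem_centralizer_iff ℂ).1 hfa g hg
    refine ⟨fun x hx => ⟨(hL.prop.2 g hg).1 x hx.1, ?_⟩,
      fun x hx => ⟨(hL.prop.2 g hg).2 x hx.1, ?_⟩⟩
    · have h1 : (f * a - c • 1) x = 0 := hx.2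
      have h2 : (f * a - c • 1) * g = g * (f * a - c • 1) := by
        rw [sub_mul, mul_sub, hcomm.1]; simp
      change ((f * a - c • 1) * g) x = 0
      rw [h2, Module.End.mul_apply, h1, map_zero]
    · have h1 : (f * a - c • 1) x = 0 := hx.2
      have h2 : (f * a - c • 1) * star g = star g * (f * a - c • 1) := by
        rw [sub_mul, mul_sub, hcomm.2]; simp
      change ((f * a - c • 1) * star g) x = 0
      rw [h2, Module.End.mul_apply, h1, map_zero]
  have hle : L ≤ L ⊓ LinearMap.ker (f * a - c • 1) := by
    refine hL.le_of_le ⟨fun h => hv0 ?_, hM⟩ inf_le_left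
    have h1 : t v = c • v := Module.End.mem_eigenspace_iff.1 hv
    have h2 : (v : K) ∈ L ⊓ LinearMap.ker (f * a - c • 1) := by
      refine ⟨v.2, ?_⟩
      have h3 := congrArg Subtype.val h1
      change (f * a) v - c • (v : K) = 0
      exact sub_eq_zero.2 h3
    rw [h] at h2
    exact Subtype.ext ((Submodule.mem_bot ℂ).1 h2)
  refine ⟨c, ?_⟩
  ext1 x
  have h := (hle (hfx x)).2
  exact sub_eq_zero.1 h

/-- Resolution of the identity into pairwise orthogonal minimal projections of the commutant. -/
theorem exists_minimal_projections (S : Set (Module.End ℂ K)) :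
    ∃ (ι : Type u) (_ : Fintype ι) (_ : DecidableEq ι) (f : ι → Module.End ℂ K),
      (∀ k, f k ∈ StarSubalgebra.centralizer ℂ S) ∧ (∀ k, star (f k) = f k) ∧
      (∀ k l, f k * f l = if k = l then f k else 0) ∧ ∑ k, f k = 1 ∧ (∀ k, f k ≠ 0) ∧
      ∀ a ∈ StarSubalgebra.centralizer ℂ S, ∀ k, ∃ c : ℂ, f k * a * f k = c • f k := by
  classical
  obtain ⟨s, hs, hs', hsup⟩ := exists_orthogonal_minimal_reducing (S := S) ⊤
    fun g _ => ⟨fun _ _ => trivial, fun _ _ => trivial⟩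
  have hfam : OrthogonalFamily ℂ (fun L : s => L.1) fun L => L.1.subtypeₗᵢ :=
    OrthogonalFamily.of_pairwise fun L M h => hs' L.2 M.2 fun h' => h (Subtype.ext h')
  refine ⟨s, inferInstance, inferInstance, fun L => (L.1.starProjection : Module.End ℂ K),
    fun L => starProjection_mem_centralizer (hs L.1 L.2).prop.2, fun L => ?_, fun L M => ?_, ?_,
    fun L h => ?_, fun a ha L => exists_compression_eq_smul (hs L.1 L.2) ha⟩
  · rw [LinearMap.star_eq_adjoint]
    exact (Submodule.starProjection_isSymmetric L.1).adjoint_eq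
  · split_ifs with h
    · subst h
      ext1 x
      exact Submodule.starProjection_eq_self_iff.2 (Submodule.starProjection_apply_mem _ _)
    · ext1 x
      change L.1.starProjection (M.1.starProjection x) = 0
      rw [Submodule.starProjection_apply_eq_zero_iff]
      exact (hs' L.2 M.2 fun h' => h (Subtype.ext h')).symm
        (Submodule.starProjection_apply_mem _ _)
  · ext1 x
    have hx : x ∈ ⨆ L : s, L.1 := by
      rw [Finset.sup_eq_iSup] at hsup
      simp only [id, iSup_subtype'] at hsup
      rw [hsup]; trivial
    rw [LinearMap.sum_apply]
    exact hfam.sum_projection_of_mem_iSup x hx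
  · refine (hs L.1 L.2).prop.1 ((Submodule.eq_bot_iff _).2 fun x hx => ?_)
    have h1 := LinearMap.congr_fun h x
    rw [← Submodule.starProjection_eq_self_iff.2 hx]
    exact h1

end MinimalProjections

/-! ### Matrix units and multiplicity spaces -/

section MatrixUnits

variable {K : Type u} [NormedAddCommGroup K] [InnerProductSpace ℂ K] [FiniteDimensional ℂ K]

/-- Polar decomposition of `T = e * a * f`: minimality makes `T† T` and `T T†` multiples of
`f` and `e`, necessarily by the same positive number, so `T` can be rescaled to a partial
isometry. -/
theorem exists_partial_isometry {A : StarSubalgebra ℂ (Module.End ℂ K)} {e f : Module.End ℂ K}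
    (heA : e ∈ A) (hfA : f ∈ A) (he : star e = e) (hf : star f = f)
    (hee : e * e = e) (hff : f * f = f)
    (hemin : ∀ a ∈ A, ∃ c : ℂ, e * a * e = c • e) (hfmin : ∀ a ∈ A, ∃ c : ℂ, f * a * f = c • f)
    {a : Module.End ℂ K} (ha : a ∈ A) (h : e * a * f ≠ 0) :
    ∃ w ∈ A, w * star w = e ∧ star w * w = f ∧ e * w = w := by
  set T := e * a * f with hT
  have hTA : T ∈ A := mul_mem (mul_mem heA ha) hfA
  have heT : e * T = T := by rw [hT, ← mul_assoc, ← mul_assoc, hee]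
  have hTf : T * f = T := by rw [hT, mul_assoc, hff]
  have hfT : f * star T = star T := by rw [← hf, ← star_mul, hTf]
  have hTe : star T * e = star T := by rw [← he, ← star_mul, heT]
  obtain ⟨c, hc⟩ := hfmin _ (mul_mem (star_mem hTA) hTA)
  obtain ⟨d, hd⟩ := hemin _ (mul_mem hTA (star_mem hTA))
  rw [← mul_assoc, hfT, mul_assoc, hTf] at hc
  rw [← mul_assoc, heT, mul_assoc, hTe] at hd
  have hdc : d = c := by
    have h1 : d • T = c • T := by
      calc d • T = d • (e * T) := by rw [heT]
        _ = T * star T * T := by rw [hd, smul_mul_assoc]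
        _ = c • T := by rw [mul_assoc, hc, mul_smul_comm, hTf]
    exact smul_left_injective ℂ h h1
  have hf0 : f ≠ 0 := by
    rintro rfl
    exact h (by rw [hT, mul_zero])
  obtain ⟨y, hy⟩ : ∃ y, f y ≠ 0 := by
    by_contra! h'
    exact hf0 (LinearMap.ext h')
  -- The multiple `c` in `T† T = c f` is `(‖T x‖ / ‖x‖)²` for any nonzero `x = f y`.
  have hnorm : (‖T (f y)‖ : ℂ) ^ 2 = c * (‖f y‖ : ℂ) ^ 2 := by
    have h1 : inner ℂ (f y) ((star T * T) (f y)) = c * inner ℂ (f y) (f y) := by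
      rw [hc, LinearMap.smul_apply, ← Module.End.mul_apply f f, hff, inner_smul_right]
    rw [Module.End.mul_apply, LinearMap.star_eq_adjoint, LinearMap.adjoint_inner_right,
      inner_self_eq_norm_sq_to_K, inner_self_eq_norm_sq_to_K] at h1
    exact h1
  have hy' : (‖f y‖ : ℂ) ≠ 0 := by simpa using hy
  set r : ℝ := ‖T (f y)‖ / ‖f y‖ with hr
  have hcr : c = (r : ℂ) * r := by
    rw [hr]; push_cast; field_simp; rw [hnorm]
  have hr0 : (r : ℂ) ≠ 0 := by
    intro h0
    rw [hcr, h0, mul_zero, zero_smul] at hc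
    exact h (star_mul_self_eq_zero_iff.1 hc)
  have hstar : star ((r : ℂ)⁻¹ • T) = (r : ℂ)⁻¹ • star T := by
    rw [star_smul]; simp
  refine ⟨(r : ℂ)⁻¹ • T, A.toSubalgebra.smul_mem hTA _, ?_, ?_, ?_⟩
  · rw [hstar, smul_mul_smul_comm, hd, hdc, hcr, smul_smul]
    field_simp; simp
  · rw [hstar, smul_mul_smul_comm, hc, hcr, smul_smul]
    field_simp; simp
  · rw [mul_smul_comm, heT]

/-- Minimal projections of `A`, grouped into their Murray-von Neumann classes `cls k`, with a
partial isometry `w k` of `A` from a representative of the class of `f k` to `f k`. -/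
theorem exists_matrix_units {A : StarSubalgebra ℂ (Module.End ℂ K)} {ι : Type u} [Fintype ι]
    [DecidableEq ι] {f : ι → Module.End ℂ K} (hA : ∀ k, f k ∈ A) (hstar : ∀ k, star (f k) = f k)
    (hmul : ∀ k l, f k * f l = if k = l then f k else 0)
    (hmin : ∀ a ∈ A, ∀ k, ∃ c : ℂ, f k * a * f k = c • f k) :
    ∃ (Q : Type u) (_ : Fintype Q) (_ : DecidableEq Q) (cls : ι → Q) (r : Q → ι)
      (w : ι → Module.End ℂ K),
      (∀ k, w k ∈ A) ∧ (∀ k, w k * star (w k) = f k) ∧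
      (∀ k l, star (w k) * w l = if k = l then f (r (cls k)) else 0) ∧
      ∀ a ∈ A, ∀ k l, cls k ≠ cls l → f k * a * f l = 0 := by
  classical
  have hidem (k) : f k * f k = f k := by rw [hmul, if_pos rfl]
  -- Murray-von Neumann equivalence, with a partial isometry `w = f k * w * f l` in `A` as witness.
  let R : Setoid ι :=
    { r := fun k l => ∃ w ∈ A, w * star w = f k ∧ star w * w = f l ∧ f k * w = w
      iseqv :=
        { refl := fun k => ⟨f k, hA k, by rw [hstar, hidem], by rw [hstar, hidem], hidem k⟩
          symm := by
            rintro k l ⟨w, hw, h1, h2, h3⟩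
            refine ⟨star w, star_mem hw, by rw [star_star, h2], by rw [star_star, h1], ?_⟩
            rw [← h2, mul_assoc, h1, ← hstar k, ← star_mul, h3]
          trans := by
            rintro k l m ⟨w, hw, h1, h2, h3⟩ ⟨v, hv, h4, h5, h6⟩
            refine ⟨w * v, mul_mem hw hv, ?_, ?_, by rw [← mul_assoc, h3]⟩
            · rw [star_mul, mul_assoc, ← mul_assoc v, h4, ← h2, ← mul_assoc, ← mul_assoc, h1, h3,
                h1]
            · rw [star_mul, mul_assoc, ← mul_assoc (star w), h2, h6, h5] } }
  have hex (k : ι) := Quotient.exact (s := R) (Quotient.out_eq (Quotient.mk R k)).symm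
  choose w hwA hw1 hw2 hw3 using hex
  refine ⟨Quotient R, inferInstance, inferInstance, Quotient.mk R, Quotient.out, w, hwA, hw1,
    fun k l => ?_, fun a ha k l hkl => ?_⟩
  · split_ifs with hkl
    · subst hkl; exact hw2 k
    · rw [← hw3 k, ← hw3 l, star_mul, hstar, mul_assoc, ← mul_assoc (f k), hmul, if_neg hkl]
      simp
  · by_contra h0
    exact hkl (Quotient.sound (exists_partial_isometry (hA k) (hA l) (hstar k) (hstar l) (hidem k)
      (hidem l) (fun a ha => hmin a ha k) (fun a ha => hmin a ha l) ha h0))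

end MatrixUnits

section Multiplicity

variable {K : Type u} [NormedAddCommGroup K] [InnerProductSpace ℂ K] {κ : Type u} [Fintype κ]

/-- The map `ℂ^κ → K` that sends the basis vector `k` to `w k y`. -/
noncomputable def coordEmb (w : κ → Module.End ℂ K) (y : K) : EuclideanSpace ℂ κ →ₗ[ℂ] K where
  toFun z := ∑ k, z k • w k y
  map_add' z z' := by simp [add_smul, Finset.sum_add_distrib]
  map_smul' c z := by simp [mul_smul, Finset.smul_sum]

theorem coordEmb_apply (w : κ → Module.End ℂ K) (y : K) (z : EuclideanSpace ℂ κ) :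
    coordEmb w y z = ∑ k, z k • w k y := rfl

theorem coordEmb_single [DecidableEq κ] (w : κ → Module.End ℂ K) (y : K) (k : κ) :
    coordEmb w y (EuclideanSpace.single k 1) = w k y := by
  simp [coordEmb_apply]

variable [FiniteDimensional ℂ K]

theorem adjoint_coordEmb_apply (w : κ → Module.End ℂ K) (y x : K) (k : κ) :
    (coordEmb w y).adjoint x k = inner ℂ (w k y) x := by
  classical
  rw [← coordEmb_single w y k, ← LinearMap.adjoint_inner_right, EuclideanSpace.inner_single_left]
  simp

theorem adjoint_coordEmb_comp_of_orthogonal {κ' : Type u} [Fintype κ'] {w : κ → Module.End ℂ K}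
    {v : κ' → Module.End ℂ K} (h : ∀ k l, star (w k) * v l = 0) (y y' : K) :
    (coordEmb w y).adjoint ∘ₗ coordEmb v y' = 0 := by
  ext z k
  rw [LinearMap.comp_apply, adjoint_coordEmb_apply, coordEmb_apply, inner_sum]
  refine Finset.sum_eq_zero fun l _ => ?_
  rw [inner_smul_right, ← LinearMap.adjoint_inner_right, ← LinearMap.star_eq_adjoint,
    ← Module.End.mul_apply, h]
  simp

theorem adjoint_coordEmb_comp_self [DecidableEq κ] {w : κ → Module.End ℂ K} {g : Module.End ℂ K}
    (h : ∀ k l, star (w k) * w l = if k = l then g else 0) (y y' : K) :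
    (coordEmb w y).adjoint ∘ₗ coordEmb w y' = inner ℂ y (g y') • LinearMap.id := by
  ext z k
  rw [LinearMap.comp_apply, adjoint_coordEmb_apply, coordEmb_apply, inner_sum,
    Finset.sum_eq_single k]
  · rw [inner_smul_right, ← LinearMap.adjoint_inner_right, ← LinearMap.star_eq_adjoint,
      ← Module.End.mul_apply, h, if_pos rfl]
    simp [mul_comm]
  · intro l _ hl
    rw [inner_smul_right, ← LinearMap.adjoint_inner_right, ← LinearMap.star_eq_adjoint,
      ← Module.End.mul_apply, h, if_neg hl.symm]
    simp
  · simp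

/-- The `*`-homomorphism that sends the matrix unit `(k, l)` to `w k * star (w l)`, in Kraus
form. -/
theorem sum_conj_coordEmb [DecidableEq κ] {β : Type*} [Fintype β] (b : OrthonormalBasis β ℂ K)
    (w : κ → Module.End ℂ K) (Z : Module.End ℂ (EuclideanSpace ℂ κ)) :
    ∑ i, coordEmb w (b i) ∘ₗ Z ∘ₗ (coordEmb w (b i)).adjoint =
      ∑ k, ∑ l, Z (EuclideanSpace.single l 1) k • (w k * star (w l)) := by
  ext1 x
  have hZ (i : β) (k : κ) : Z ((coordEmb w (b i)).adjoint x) k =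
      ∑ l, inner ℂ (w l (b i)) x * Z (EuclideanSpace.single l 1) k := by
    rw [← (EuclideanSpace.basisFun κ ℂ).sum_repr ((coordEmb w (b i)).adjoint x)]
    simp [adjoint_coordEmb_apply]
  have hx (l : κ) : star (w l) x = ∑ i, inner ℂ (w l (b i)) x • b i := by
    rw [← b.sum_repr' (star (w l) x)]
    simp [LinearMap.star_eq_adjoint, LinearMap.adjoint_inner_right]
  simp only [LinearMap.sum_apply, LinearMap.comp_apply, LinearMap.smul_apply, coordEmb_apply, hZ,
    Module.End.mul_apply, hx, map_sum, map_smul, Finset.smul_sum,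
    Finset.sum_smul, smul_smul]
  rw [Finset.sum_comm]
  refine Finset.sum_congr rfl fun k _ => ?_
  rw [Finset.sum_comm]
  refine Finset.sum_congr rfl fun l _ => Finset.sum_congr rfl fun i _ => ?_
  rw [mul_comm]

/-- The trace dual of a map in Kraus form, here between different spaces. -/
theorem trace_mul_sum_adjoint_conj {E : Type*} [NormedAddCommGroup E] [InnerProductSpace ℂ E]
    [FiniteDimensional ℂ E] {β : Type*} [Fintype β] (W : β → (E →ₗ[ℂ] K)) (Z : Module.End ℂ E)
    (X : Module.End ℂ K) :
    LinearMap.trace ℂ E (Z * ∑ i, (W i).adjoint ∘ₗ X ∘ₗ W i) =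
      LinearMap.trace ℂ K ((∑ i, W i ∘ₗ Z ∘ₗ (W i).adjoint) * X) := by
  have h : (∑ i, W i ∘ₗ Z ∘ₗ (W i).adjoint) * X = ∑ i, (W i ∘ₗ Z ∘ₗ (W i).adjoint) * X :=
    Finset.sum_mul (R := Module.End ℂ K) ..
  rw [h, Finset.mul_sum, map_sum, map_sum]
  refine Finset.sum_congr rfl fun i _ => ?_
  change LinearMap.trace ℂ E ((Z ∘ₗ (W i).adjoint ∘ₗ X) ∘ₗ W i) =
    LinearMap.trace ℂ K (W i ∘ₗ (Z ∘ₗ (W i).adjoint ∘ₗ X))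
  rw [LinearMap.trace_comp_comm']

/-- An operator `a` is recovered from its compressions `J† a J` to the multiplicity spaces of the
classes `q`, where `J = coordEmb w (ξ q)`: it is the sum of their images under the
`*`-homomorphisms of `sum_conj_coordEmb`. The hypotheses on `a` hold for all elements of an algebra
in which the `f k` are minimal projections with classes `cls k`. -/
theorem sum_class_compression {ι Q : Type u} [Fintype ι] [DecidableEq ι] [Fintype Q]
    [DecidableEq Q] (cls : ι → Q) {f w : ι → Module.End ℂ K} {g : Q → Module.End ℂ K} {ξ : Q → K}
    {β : Type*} [Fintype β] (b : OrthonormalBasis β ℂ K) (hf : ∑ k, f k = 1)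
    (hwf : ∀ k, w k * star (w k) = f k) (hwg : ∀ k, star (w k) * w k = g (cls k))
    (hgg : ∀ q, g q * g q = g q)
    (hξ : ∀ q, g q (ξ q) = ξ q) (hξ1 : ∀ q, inner ℂ (ξ q) (ξ q) = (1 : ℂ)) (a : Module.End ℂ K)
    (hac : ∀ k l, cls k = cls l → ∃ c : ℂ, star (w k) * a * w l = c • g (cls l))
    (ha : ∀ k l, cls k ≠ cls l → f k * a * f l = 0) :
    ∑ q, ∑ i, coordEmb (fun k : {k // cls k = q} => w k) (b i) ∘ₗ
      ((coordEmb (fun k : {k // cls k = q} => w k) (ξ q)).adjoint ∘ₗ a ∘ₗ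
        coordEmb (fun k : {k // cls k = q} => w k) (ξ q)) ∘ₗ
      (coordEmb (fun k : {k // cls k = q} => w k) (b i)).adjoint = a := by
  have hwgw (k) : w k * g (cls k) = w k := mul_eq_self_of_star_mul_self (hwg k) (hgg _)
  have hterm (q : Q) (k l : {k // cls k = q}) :
      ((coordEmb (fun k : {k // cls k = q} => w k) (ξ q)).adjoint ∘ₗ a ∘ₗ
        coordEmb (fun k : {k // cls k = q} => w k) (ξ q)) (EuclideanSpace.single l 1) k •
        (w k * star (w l)) = f k * a * f l := by
    obtain ⟨k, hk⟩ := k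
    obtain ⟨l, rfl⟩ := l
    obtain ⟨c, hc⟩ := hac k l hk
    have h1 : inner ℂ (w k (ξ (cls l))) (a (w l (ξ (cls l)))) = c := by
      rw [← LinearMap.adjoint_inner_right, ← LinearMap.star_eq_adjoint]
      change inner ℂ (ξ (cls l)) ((star (w k) * a * w l) (ξ (cls l))) = c
      rw [hc, LinearMap.smul_apply, hξ, inner_smul_right, hξ1, mul_one]
    rw [LinearMap.comp_apply, adjoint_coordEmb_apply, LinearMap.comp_apply, coordEmb_single, h1,
      ← hwf, ← hwf]
    calc c • (w k * star (w l)) = w k * (c • g (cls l)) * star (w l) := by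
          rw [mul_smul_comm, smul_mul_assoc, ← hk, hwgw]
      _ = w k * star (w k) * a * (w l * star (w l)) := by
          rw [← hc]; simp only [mul_assoc]
  simp only [sum_conj_coordEmb, hterm]
  calc ∑ q, ∑ k : {k // cls k = q}, ∑ l : {k // cls k = q}, f k * a * f l
      = ∑ q, ∑ k : {k // cls k = q}, ∑ l, f k * a * f l := by
        refine Finset.sum_congr rfl fun q _ => Finset.sum_congr rfl fun k _ => ?_
        rw [← Fintype.sum_fiberwise cls fun l => f k * a * f l, Finset.sum_eq_single q]
        · intro q' _ h
          refine Finset.sum_eq_zero fun l _ => ha k l ?_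
          rw [k.2, l.2]
          exact h.symm
        · simp
    _ = ∑ k, ∑ l, f k * a * f l := Fintype.sum_fiberwise cls fun k => ∑ l, f k * a * f l
    _ = a := by
        simp only [← Finset.mul_sum, hf, mul_one, ← Finset.sum_mul, one_mul]

end Multiplicity

/-! ### Kraus decompositions of completely positive maps -/

section Kets

variable {E F : Type*} [NormedAddCommGroup E] [InnerProductSpace ℂ E]
  [NormedAddCommGroup F] [InnerProductSpace ℂ F]

/-- The operator `|x⟩⟨y|`, that is, `z ↦ ⟪y, z⟫ • x`. -/
noncomputable def ketBra (x : E) (y : F) : F →ₗ[ℂ] E := (innerₛₗ ℂ y).smulRight x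

theorem ketBra_apply (x : E) (y z : F) : ketBra x y z = inner ℂ y z • x := rfl

theorem ketBra_sum_sum {ι ι' : Type*} [Fintype ι] [Fintype ι'] (x : ι → E) (y : ι' → F) :
    ketBra (∑ i, x i) (∑ j, y j) = ∑ i, ∑ j, ketBra (x i) (y j) := by
  ext z
  simp only [ketBra_apply, LinearMap.sum_apply, sum_inner, Finset.smul_sum, Finset.sum_smul]

theorem map_ketBra {E' F' : Type*} [NormedAddCommGroup E'] [InnerProductSpace ℂ E']
    [NormedAddCommGroup F'] [InnerProductSpace ℂ F'] (x : E) (y : F) (x' : E') (y' : F') :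
    TensorProduct.map (ketBra x y) (ketBra x' y') = ketBra (x ⊗ₜ[ℂ] x') (y ⊗ₜ[ℂ] y') := by
  ext z z'
  simp [ketBra_apply, TensorProduct.inner_tmul, ← TensorProduct.smul_tmul', smul_smul, mul_comm]

theorem eq_sum_ketBra {ι : Type*} [Fintype ι] (b : OrthonormalBasis ι ℂ E) (X : E →ₗ[ℂ] E) :
    X = ∑ i, ∑ j, inner ℂ (b i) (X (b j)) • ketBra (b i) (b j) := by
  ext z
  conv_lhs => rw [← b.sum_repr' z, map_sum]
  simp only [map_smul, LinearMap.sum_apply, LinearMap.smul_apply, ketBra_apply]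
  rw [Finset.sum_comm]
  refine Finset.sum_congr rfl fun j _ => ?_
  conv_lhs => rw [← b.sum_repr' (X (b j))]
  rw [Finset.smul_sum]
  exact Finset.sum_congr rfl fun i _ => smul_comm _ _ _

theorem exists_eq_sum_ketBra_of_isPositive [FiniteDimensional ℂ E] {T : E →ₗ[ℂ] E}
    (hT : T.IsPositive) : ∃ (m : ℕ) (u : Fin m → E), T = ∑ i, ketBra (u i) (u i) := by
  have h : (LinearMap.toContinuousLinearMap T).IsPositive := by
    rwa [← LinearMap.isPositive_toContinuousLinearMap_iff] at hT
  obtain ⟨m, u, hu⟩ := ContinuousLinearMap.isPositive_iff_eq_sum_rankOne.1 h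
  refine ⟨m, u, ?_⟩
  ext z
  have h1 := congrArg (fun S : E →L[ℂ] E => S z) hu
  simpa [ketBra_apply] using h1

end Kets

namespace QuantMixed

/-- Choi's theorem: a completely positive map has a Kraus decomposition. Positivity is used for
`f ⊗ id_H` at the single operator `|Ω⟩⟨Ω|` with `Ω = ∑ bᵢ ⊗ bᵢ`: a decomposition of its image into
`|u_k⟩⟨u_k|` yields the Kraus operators `bᵢ ↦ (id ⊗ ⟨bᵢ|) u_k`. -/
theorem IsCompletelyPositive.exists_eq_sum_conj {H H' : QuantMixed.{u}}
    {f : H.Op →ₗ[ℂ] H'.Op} (hf : IsCompletelyPositive f) :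
    ∃ (m : ℕ) (V : Fin m → (H →ₗ[ℂ] H')), f = ∑ k, QuantMixed.conj (V k) := by
  let b := stdOrthonormalBasis ℂ H
  let Ω : H ⊗[ℂ] H := ∑ i, b i ⊗ₜ[ℂ] b i
  have hΩ : (ketBra Ω Ω).IsPositive := by
    rw [← LinearMap.isPositive_toContinuousLinearMap_iff,
      ContinuousLinearMap.isPositive_iff_eq_sum_rankOne]
    exact ⟨1, fun _ => Ω, by ext; simp [ketBra_apply]⟩
  obtain ⟨m, u, hu⟩ := exists_eq_sum_ketBra_of_isPositive (hf H _ hΩ)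
  have hchoi : ampliation H f (ketBra Ω Ω) =
      ∑ i, ∑ j, TensorProduct.map (f (ketBra (b i) (b j))) (ketBra (b i) (b j)) := by
    simp only [Ω, ketBra_sum_sum, ← map_ketBra, map_sum, ampliation_map]
  -- `R j` is `y ↦ y ⊗ b j`, and its adjoint is the partial contraction `id ⊗ ⟨b j|`.
  let R (j : Fin (Module.finrank ℂ H)) : H' →ₗ[ℂ] H' ⊗[ℂ] H :=
    (TensorProduct.mk ℂ H' H).flip (b j)
  have hR (i) (y : H') (z : H) : (R i).adjoint (y ⊗ₜ z) = inner ℂ (b i) z • y := by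
    refine ext_inner_left ℂ fun x => ?_
    rw [LinearMap.adjoint_inner_right, inner_smul_right]
    simp [R, TensorProduct.inner_tmul, mul_comm]
  let V (k : Fin m) : H →ₗ[ℂ] H' := ∑ i, ketBra ((R i).adjoint (u k)) (b i)
  have hV (k i) : V k (b i) = (R i).adjoint (u k) := by
    simp [V, ketBra_apply, OrthonormalBasis.inner_eq_ite]
  have hE (i j) : f (ketBra (b i) (b j)) = ∑ k, QuantMixed.conj (V k) (ketBra (b i) (b j)) := by
    have h1 : (R i).adjoint ∘ₗ ampliation H f (ketBra Ω Ω) ∘ₗ R j = f (ketBra (b i) (b j)) := by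
      ext y
      rw [hchoi]
      simp [R, ketBra_apply, OrthonormalBasis.inner_eq_ite, hR, apply_ite (inner ℂ (b i))]
    rw [← h1, hu]
    ext y
    simp [QuantMixed.conj, ketBra_apply, LinearMap.sum_apply, hV, LinearMap.adjoint_inner_right,
      LinearMap.adjoint_inner_left]
  refine ⟨m, V, ?_⟩
  ext1 X
  rw [eq_sum_ketBra b X]
  simp only [map_sum, map_smul, hE, LinearMap.sum_apply, Finset.smul_sum]

end QuantMixed

/-! ### Idempotents in semi-additive categories, and direct sums of Hilbert spaces -/

theorem IsCausal.comp {C : Type u} [Category.{v} C] [CategoryWithDiscarding C] {A B D : C}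
    {f : A ⟶ B} {g : B ⟶ D} (hf : IsCausal f) (hg : IsCausal g) : IsCausal (f ≫ g) := by
  rw [IsCausal, Category.assoc, hg, hf]

section SemiAdditive

variable {C : Type u} [Category.{v} C] [SemiAdditive C]

theorem SemiAdditive.sum_comp {A B D : C} {ι : Type*} (s : Finset ι) (f : ι → (A ⟶ B))
    (h : B ⟶ D) : (∑ i ∈ s, f i) ≫ h = ∑ i ∈ s, f i ≫ h :=
  map_sum (⟨⟨fun f => f ≫ h, SemiAdditive.zero_comp h⟩,
    fun f g => SemiAdditive.add_comp f g h⟩ : (A ⟶ B) →+ (A ⟶ D)) f s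

theorem SemiAdditive.comp_sum {A B D : C} {ι : Type*} (s : Finset ι) (h : A ⟶ B)
    (f : ι → (B ⟶ D)) : h ≫ (∑ i ∈ s, f i) = ∑ i ∈ s, h ≫ f i :=
  map_sum (⟨⟨fun f => h ≫ f, SemiAdditive.comp_zero h⟩,
    fun f g => SemiAdditive.comp_add h f g⟩ : (B ⟶ D) →+ (A ⟶ D)) f s

variable [CategoryWithDiscarding C]

/-- If an idempotent `p` factors as `W ≫ V` with `V` causal, a biorthogonal decomposition of
`V ≫ W` transports to a causal finite decomposition of `p`. -/
theorem nonempty_causalFiniteDecomposition_of_factor {A B : C} {p : A ⟶ A} (hp : IsIdempotent p)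
    {W : A ⟶ B} {V : B ⟶ A} (hWV : W ≫ V = p) (hV : IsCausal V) {Q : Type*} [Fintype Q]
    {D : Q → C} {e : ∀ q, B ⟶ D q} {m : ∀ q, D q ⟶ B} (hme : ∀ q, m q ≫ e q = 𝟙 (D q))
    (hne : ∀ q q', q ≠ q' → m q ≫ e q' = 0) (hm : ∀ q, IsCausal (m q))
    (hsum : V ≫ W = ∑ q, e q ≫ m q) : Nonempty (CausalFiniteDecomposition p) := by
  have he (q : Q) : (V ≫ W) ≫ e q = e q := by
    rw [hsum, SemiAdditive.sum_comp, Finset.sum_eq_single q]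
    · rw [Category.assoc, hme, Category.comp_id]
    · intro q' _ h
      rw [Category.assoc, hne q' q h, SemiAdditive.comp_zero]
    · simp
  have key (q q' : Q) : (m q ≫ V) ≫ W ≫ e q' = m q ≫ e q' := by
    rw [Category.assoc, ← Category.assoc V W, he]
  let s := (Fintype.equivFin Q).symm
  refine ⟨⟨Fintype.card Q, fun i => D (s i), fun i => W ≫ e (s i), fun i => m (s i) ≫ V,
    fun i => by rw [key, hme], fun i j hij => ?_, fun i => (hm _).comp hV, ?_⟩⟩
  · have h0 : m (s j) ≫ e (s i) = 0 := hne _ _ fun h => hij (s.injective h).symm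
    rw [Category.assoc, ← Category.assoc (m (s j) ≫ V), key, h0, SemiAdditive.zero_comp,
      SemiAdditive.comp_zero]
  · rw [Equiv.sum_comp s fun q => (W ≫ e q) ≫ m q ≫ V]
    have h (q : Q) : (W ≫ e q) ≫ m q ≫ V = W ≫ (e q ≫ m q) ≫ V := by
      simp only [Category.assoc]
    rw [Finset.sum_congr rfl fun q _ => h q, ← SemiAdditive.comp_sum, ← SemiAdditive.sum_comp,
      ← hsum, Category.assoc, hWV, ← Category.assoc, hWV]
    exact hp.symm

end SemiAdditive

namespace QuantMixed

theorem comp_toLinearMap {H H' H'' : QuantMixed.{u}} (f : H ⟶ H') (g : H' ⟶ H'') :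
    (f ≫ g).toLinearMap = g.toLinearMap ∘ₗ f.toLinearMap := rfl

theorem sum_toLinearMap {H H' : QuantMixed.{u}} {ι : Type*} (s : Finset ι) (f : ι → (H ⟶ H')) :
    (∑ i ∈ s, f i).toLinearMap = ∑ i ∈ s, (f i).toLinearMap :=
  map_sum (⟨⟨fun f => f.toLinearMap, rfl⟩, fun _ _ => rfl⟩ :
    (H ⟶ H') →+ (H.Op →ₗ[ℂ] H'.Op)) f s

theorem isCausal_iff {H H' : QuantMixed.{u}} {f : H ⟶ H'} :
    IsCausal f ↔ ∀ X : H.Op, LinearMap.trace ℂ H' (f.toLinearMap X) = LinearMap.trace ℂ H X := by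
  have hinj : Function.Injective fun c : ℂ => c • (LinearMap.id : (unit.{u}).Op) := by
    have : Nontrivial (unit.{u}).carrier :=
      inferInstanceAs (Nontrivial (EuclideanSpace ℂ PUnit.{u + 1}))
    obtain ⟨x, hx⟩ := exists_ne (0 : unit.{u})
    intro c d h
    exact smul_left_injective ℂ hx (LinearMap.congr_fun h x)
  refine ⟨fun h X => hinj (LinearMap.congr_fun (congrArg Hom.toLinearMap h) X), fun h => ?_⟩
  apply Hom.ext
  ext1 X
  exact congrArg (fun c : ℂ => c • (LinearMap.id : (unit.{u}).Op)) (h X)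

/-- The morphism `X ↦ V X V†`. -/
noncomputable def conjHom {H H' : QuantMixed.{u}} (V : H →ₗ[ℂ] H') : H ⟶ H' :=
  ⟨QuantMixed.conj V, .conj V⟩

theorem conjHom_apply {H H' : QuantMixed.{u}} (V : H →ₗ[ℂ] H') (X : H.Op) :
    (conjHom V).toLinearMap X = V ∘ₗ X ∘ₗ V.adjoint := rfl

theorem conjHom_comp {H H' H'' : QuantMixed.{u}} (V : H →ₗ[ℂ] H') (W : H' →ₗ[ℂ] H'') :
    conjHom V ≫ conjHom W = conjHom (W ∘ₗ V) := by
  apply Hom.ext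
  ext1 X
  rw [comp_toLinearMap, LinearMap.comp_apply, conjHom_apply, conjHom_apply, conjHom_apply,
    LinearMap.adjoint_comp]
  rfl

theorem conjHom_id (H : QuantMixed.{u}) : conjHom (LinearMap.id : H →ₗ[ℂ] H) = 𝟙 H := by
  apply Hom.ext
  ext1 X
  rw [conjHom_apply, LinearMap.adjoint_id]
  rfl

theorem conjHom_zero (H H' : QuantMixed.{u}) : conjHom (0 : H →ₗ[ℂ] H') = 0 := by
  apply Hom.ext
  ext1 X
  rw [conjHom_apply, LinearMap.zero_comp]
  rfl

theorem isCausal_sum_conjHom {H H' : QuantMixed.{u}} {ι : Type*} [Fintype ι]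
    {V : ι → (H →ₗ[ℂ] H')} (h : ∑ i, (V i).adjoint ∘ₗ V i = LinearMap.id) :
    IsCausal (∑ i, conjHom (V i)) := by
  rw [isCausal_iff]
  intro X
  have h1 (i : ι) : LinearMap.trace ℂ H' ((conjHom (V i)).toLinearMap X) =
      LinearMap.trace ℂ H (((V i).adjoint ∘ₗ V i) ∘ₗ X) := by
    rw [conjHom_apply, LinearMap.trace_comp_comm', LinearMap.comp_assoc,
      LinearMap.trace_comp_comm', LinearMap.comp_assoc]
  rw [sum_toLinearMap, LinearMap.sum_apply, map_sum, Finset.sum_congr rfl fun i _ => h1 i,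
    ← map_sum]
  have h2 : ∑ i, ((V i).adjoint ∘ₗ V i) ∘ₗ X = (∑ i, (V i).adjoint ∘ₗ V i) ∘ₗ X :=
    (Finset.sum_mul (R := Module.End ℂ H) ..).symm
  rw [h2, h, LinearMap.id_comp]

theorem isCausal_conjHom {H H' : QuantMixed.{u}} {V : H →ₗ[ℂ] H'}
    (h : V.adjoint ∘ₗ V = LinearMap.id) : IsCausal (conjHom V) := by
  have := isCausal_sum_conjHom (V := fun _ : Unit => V) (by simpa using h)
  simpa using this

theorem exists_eq_sum_conjHom {H H' : QuantMixed.{u}} (f : H ⟶ H') :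
    ∃ (m : ℕ) (V : Fin m → (H →ₗ[ℂ] H')), f = ∑ k, conjHom (V k) := by
  obtain ⟨m, V, h⟩ := f.completelyPositive.exists_eq_sum_conj
  exact ⟨m, V, Hom.ext (by rw [h, sum_toLinearMap]; rfl)⟩

theorem sum_adjoint_comp_self_of_isCausal {H : QuantMixed.{u}} {ι : Type*} [Fintype ι]
    {V : ι → Module.End ℂ H} (h : IsCausal (∑ i, conjHom (V i))) :
    ∑ i, star (V i) * V i = 1 := by
  refine ext_trace_mul fun Z => ?_
  rw [mul_one, ← isCausal_iff.1 h Z, sum_toLinearMap, LinearMap.sum_apply, Finset.mul_sum, map_sum,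
    map_sum]
  refine Finset.sum_congr rfl fun i _ => ?_
  change _ = LinearMap.trace ℂ H (V i * (Z * star (V i)))
  rw [LinearMap.trace_mul_comm _ (V i), mul_assoc]

/-- The embedding is the orthogonal direct sum: `κ i` is conjugation by the `i`-th inclusion and `π i`
conjugation by its adjoint. The sum of the `π i ≫ κ i` removes the off-diagonal blocks, which keeps
the trace. -/
theorem hasCausalDisjointEmbeddings : HasCausalDisjointEmbeddings QuantMixed.{u} := by
  intro n A
  let X : QuantMixed.{u} := ⟨PiLp 2 fun i => (A i).carrier⟩
  let ι (i : Fin n) : A i →ₗ[ℂ] X :=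
    (WithLp.linearEquiv 2 ℂ (∀ i, (A i).carrier)).symm.toLinearMap ∘ₗ LinearMap.single ℂ (fun i => (A i).carrier) i
  let ρ (i : Fin n) : X →ₗ[ℂ] A i :=
    LinearMap.proj i ∘ₗ (WithLp.linearEquiv 2 ℂ (∀ i, (A i).carrier)).toLinearMap
  have hρ (i : Fin n) : ρ i = (ι i).adjoint := by
    rw [LinearMap.eq_adjoint_iff]
    intro x y
    change inner ℂ (x.ofLp i) y = inner ℂ x (WithLp.toLp 2 (Pi.single i y))
    rw [PiLp.inner_apply, Finset.sum_eq_single i]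
    · simp
    · intro j _ hj; simp [hj]
    · simp
  have hself (i : Fin n) : ρ i ∘ₗ ι i = LinearMap.id := by
    ext1 x
    exact Pi.single_eq_same (M := fun i => (A i).carrier) i x
  have hne (i j : Fin n) (h : i ≠ j) : ρ i ∘ₗ ι j = 0 := by
    ext1 x
    exact Pi.single_eq_of_ne (M := fun i => (A i).carrier) h x
  have hsum : ∑ i, ι i ∘ₗ ρ i = LinearMap.id := by
    ext1 x
    rw [LinearMap.sum_apply]
    refine PiLp.ext fun j => ?_
    change (∑ i, (WithLp.toLp 2 (Pi.single i (x.ofLp i)) : PiLp 2 fun i => (A i).carrier)).ofLp j =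
      x.ofLp j
    rw [WithLp.ofLp_sum, Finset.univ_sum_single]
  refine ⟨⟨X, fun i => conjHom (ι i), fun i => conjHom (ρ i), fun i => ?_, fun i j h => ?_,
    fun i => isCausal_conjHom (by rw [← hρ, hself]), ?_⟩⟩
  · rw [conjHom_comp, hself, conjHom_id]
  · rw [conjHom_comp, hne i j h, conjHom_zero]
  · simp only [conjHom_comp]
    refine isCausal_sum_conjHom ?_
    rw [← hsum]
    refine Finset.sum_congr rfl fun i _ => ?_
    rw [LinearMap.adjoint_comp, hρ, LinearMap.adjoint_adjoint, ← hρ, LinearMap.comp_assoc,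
      ← LinearMap.comp_assoc (ρ i) (ι i) (ρ i), hself, LinearMap.id_comp]

end QuantMixed

/-! ### Causal idempotents in mixed quantum theory -/

namespace QuantMixed

/-- Structure of the commutant `A` of a set of operators and their adjoints, in Kraus form: the maps
`Z ↦ ∑ i, W q i Z (W q i)†` are `*`-homomorphisms from matrix algebras to `A`, jointly inverse to
the compressions `a ↦ (J q)† a (J q)`. -/
theorem exists_commutant_blocks (K : QuantMixed.{u}) (S : Set (Module.End ℂ K)) :
    ∃ (Q : Type u) (_ : Fintype Q) (n : ℕ) (D : Q → QuantMixed.{u})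
      (W : ∀ q, Fin n → (D q →ₗ[ℂ] K)) (J : ∀ q, D q →ₗ[ℂ] K),
      (∀ q (Z : (D q).Op), ∑ i, W q i ∘ₗ Z ∘ₗ (W q i).adjoint ∈ StarSubalgebra.centralizer ℂ S) ∧
      (∀ a ∈ StarSubalgebra.centralizer ℂ S, ∑ q, ∑ i,
        W q i ∘ₗ ((J q).adjoint ∘ₗ a ∘ₗ J q) ∘ₗ (W q i).adjoint = a) ∧
      (∀ q, (J q).adjoint ∘ₗ J q = LinearMap.id) ∧
      (∀ q (X : (D q).Op), ∑ i, (W q i).adjoint ∘ₗ (J q ∘ₗ X ∘ₗ (J q).adjoint) ∘ₗ W q i = X) ∧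
      ∀ q q', q ≠ q' → ∀ i, (W q i).adjoint ∘ₗ J q' = 0 := by
  obtain ⟨ι, _, _, f, hfA, hfs, hfm, hf1, hf0, hfmin⟩ := exists_minimal_projections S
  obtain ⟨Q, _, _, cls, r, w, hwA, hwf, hww, hcls⟩ := exists_matrix_units hfA hfs hfm hfmin
  have hff (k) : f k * f k = f k := by rw [hfm, if_pos rfl]
  have hwg (k) : star (w k) * w k = f (r (cls k)) := by rw [hww, if_pos rfl]
  have hwgw (k) : w k * f (r (cls k)) = w k := mul_eq_self_of_star_mul_self (hwg k) (hff _)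
  have hξ (q : Q) : ∃ ξ : K, f (r q) ξ = ξ ∧ inner ℂ ξ ξ = (1 : ℂ) := by
    obtain ⟨y, hy⟩ : ∃ y, f (r q) y ≠ 0 := by
      by_contra! h
      exact hf0 (r q) (LinearMap.ext h)
    refine ⟨(‖f (r q) y‖⁻¹ : ℂ) • f (r q) y, ?_, ?_⟩
    · rw [map_smul, ← Module.End.mul_apply, hff]
    · rw [inner_self_eq_norm_sq_to_K, norm_smul]
      have : ‖f (r q) y‖ ≠ 0 := norm_ne_zero_iff.2 hy
      simp [this]
  choose ξ hξ hξ1 using hξ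
  let b := stdOrthonormalBasis ℂ K
  have hEE (q : Q) (y y' : K) : (coordEmb (fun k : {k // cls k = q} => w k) y).adjoint ∘ₗ
      coordEmb (fun k : {k // cls k = q} => w k) y' = inner ℂ y (f (r q) y') • LinearMap.id := by
    refine adjoint_coordEmb_comp_self (g := f (r q)) (fun k l => ?_) y y'
    rw [hww]
    simp only [Subtype.ext_iff, k.2]
  refine ⟨Q, inferInstance, _, fun q => ⟨EuclideanSpace ℂ {k // cls k = q}⟩,
    fun q i => coordEmb (fun k : {k // cls k = q} => w k) (b i),
    fun q => coordEmb (fun k : {k // cls k = q} => w k) (ξ q), fun q Z => ?_, fun a ha => ?_,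
    fun q => ?_, fun q X => ?_, fun q q' h i => ?_⟩
  · rw [sum_conj_coordEmb]
    refine sum_mem fun k _ => sum_mem fun l _ => ?_
    have hkl := mul_mem (hwA k) (star_mem (hwA l))
    exact (StarSubalgebra.centralizer ℂ S).toSubalgebra.smul_mem hkl _
  · refine sum_class_compression cls (g := fun q => f (r q)) b hf1 hwf hwg
      (fun q => hff _) hξ hξ1 a (fun k l hkl => ?_) (hcls a ha)
    obtain ⟨c, hc⟩ := hfmin _ (mul_mem (mul_mem (star_mem (hwA k)) ha) (hwA l)) (r (cls l))
    refine ⟨c, ?_⟩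
    have hk : f (r (cls k)) * star (w k) = star (w k) := by
      rw [← hfs, ← star_mul, hwgw]
    rw [← hc, mul_assoc _ _ (f (r (cls l))), mul_assoc _ (w l), hwgw, ← mul_assoc, ← mul_assoc,
      ← hkl, hk]
  · exact (hEE q (ξ q) (ξ q)).trans (by rw [hξ, hξ1, one_smul])
  · have h1 (i) : (coordEmb (fun k : {k // cls k = q} => w k) (b i)).adjoint ∘ₗ
        (coordEmb (fun k : {k // cls k = q} => w k) (ξ q) ∘ₗ X ∘ₗ
          (coordEmb (fun k : {k // cls k = q} => w k) (ξ q)).adjoint) ∘ₗ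
          coordEmb (fun k : {k // cls k = q} => w k) (b i) =
        (inner ℂ (ξ q) (b i) * inner ℂ (b i) (ξ q)) • X := by
      have h2 := hEE q (ξ q) (b i)
      rw [← LinearMap.adjoint_inner_left, ← LinearMap.star_eq_adjoint, hfs, hξ] at h2
      have h3 := hEE q (b i) (ξ q)
      rw [hξ] at h3
      rw [LinearMap.comp_assoc, LinearMap.comp_assoc, h2, ← LinearMap.comp_assoc, h3,
        LinearMap.comp_smul, LinearMap.comp_smul, LinearMap.smul_comp, LinearMap.comp_id,
        LinearMap.id_comp, smul_smul]
    rw [Finset.sum_congr rfl fun i _ => h1 i, ← Finset.sum_smul, b.sum_inner_mul_inner, hξ1,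
      one_smul]
  · refine adjoint_coordEmb_comp_of_orthogonal (fun k l => ?_) _ _
    rw [hww, if_neg]
    rintro hkl
    exact h (by rw [← k.2, ← l.2, hkl])

/-- A causal idempotent with a faithful fixed state decomposes: its trace dual projects onto the
commutant of the Kraus operators, which is a finite product of matrix algebras. -/
theorem exists_decomposition_of_faithful {K : QuantMixed.{u}} {p : K ⟶ K} (hp : IsIdempotent p)
    (hpc : IsCausal p) {ρ : K.Op} (hρ : ρ.IsPositive) (hρ' : ∀ x, inner ℂ (ρ x) x = 0 → x = 0)
    (hfix : p.toLinearMap ρ = ρ) :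
    ∃ (Q : Type u) (_ : Fintype Q) (D : Q → QuantMixed.{u}) (e : ∀ q, K ⟶ D q)
      (m : ∀ q, D q ⟶ K), (∀ q, m q ≫ e q = 𝟙 (D q)) ∧ (∀ q q', q ≠ q' → m q ≫ e q' = 0) ∧
      (∀ q, IsCausal (m q)) ∧ p = ∑ q, e q ≫ m q := by
  obtain ⟨N, V, hV⟩ := exists_eq_sum_conjHom p
  have hpV (X : Module.End ℂ K) : p.toLinearMap X = ∑ i, V i * X * star (V i) := by
    rw [hV, sum_toLinearMap, LinearMap.sum_apply]; rfl
  have hunital : ∑ i, star (V i) * V i = 1 := sum_adjoint_comp_self_of_isCausal (hV ▸ hpc)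
  have hdual (Z X : Module.End ℂ K) : LinearMap.trace ℂ K (Z * p.toLinearMap X) =
      LinearMap.trace ℂ K (heisenberg V Z * X) := by
    rw [hpV]; exact trace_mul_sum_conj V Z X
  -- `p` is idempotent, so its trace dual is, and the values of the dual are fixed points.
  have hpp (X : K.Op) : p.toLinearMap (p.toLinearMap X) = p.toLinearMap X :=
    LinearMap.congr_fun (congrArg Hom.toLinearMap hp) X
  have hqA (a : Module.End ℂ K) :
      heisenberg V a ∈ StarSubalgebra.centralizer ℂ (Set.range V) := by
    refine mem_centralizer_of_heisenberg_eq hρ hρ' ((hpV ρ).symm.trans hfix) hunital ?_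
    refine ext_trace_mul fun Z => ?_
    rw [LinearMap.trace_mul_comm, ← hdual, ← hdual, hpp, hdual, LinearMap.trace_mul_comm]
  obtain ⟨Q, _, n, D, W, J, hWA, hWJ, hJJ, hJW, hne⟩ := exists_commutant_blocks K (Set.range V)
  let e (q : Q) : K ⟶ D q := ∑ i, conjHom (W q i).adjoint
  have he (q : Q) (X : K.Op) : (e q).toLinearMap X = ∑ i, (W q i).adjoint ∘ₗ X ∘ₗ W q i := by
    simp only [e, sum_toLinearMap, LinearMap.sum_apply, conjHom_apply, LinearMap.adjoint_adjoint]
  -- Dually: the `*`-homomorphism takes values in the fixed points of the dual of `p`.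
  have hpe (q : Q) : p ≫ e q = e q := by
    apply Hom.ext
    ext1 X
    refine ext_trace_mul fun Z => ?_
    rw [comp_toLinearMap, LinearMap.comp_apply, he, he, trace_mul_sum_adjoint_conj,
      trace_mul_sum_adjoint_conj, hdual, heisenberg_of_mem_centralizer hunital (hWA q Z)]
  -- The trace dual of `e q ≫ m q`: apply the dual of `p`, compress by `J q`, and embed again.
  have hq (q : Q) (Z X : Module.End ℂ K) : LinearMap.trace ℂ K
      (Z * (e q ≫ conjHom (J q) ≫ p).toLinearMap X) =
      LinearMap.trace ℂ K ((∑ i, W q i ∘ₗ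
        ((J q).adjoint ∘ₗ heisenberg V Z ∘ₗ J q) ∘ₗ (W q i).adjoint) * X) := by
    rw [comp_toLinearMap, comp_toLinearMap, LinearMap.comp_apply, LinearMap.comp_apply, hdual,
      ← trace_mul_sum_adjoint_conj, ← he, conjHom_apply]
    exact LinearMap.trace_comp_comm' (J q).adjoint
      ((heisenberg V Z ∘ₗ J q) ∘ₗ (e q).toLinearMap X)
  refine ⟨Q, inferInstance, D, e, fun q => conjHom (J q) ≫ p, fun q => ?_,
    fun q q' h => ?_, fun q => (isCausal_conjHom (hJJ q)).comp hpc, ?_⟩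
  · rw [Category.assoc, hpe]
    apply Hom.ext
    ext1 X
    rw [comp_toLinearMap, LinearMap.comp_apply, he, conjHom_apply, hJW]
    rfl
  · rw [Category.assoc, hpe]
    simp only [e, SemiAdditive.comp_sum, conjHom_comp]
    refine Finset.sum_eq_zero fun i _ => ?_
    rw [hne q' q h.symm, conjHom_zero]
  · apply Hom.ext
    ext1 X
    refine ext_trace_mul fun Z => ?_
    rw [sum_toLinearMap, LinearMap.sum_apply, Finset.mul_sum, map_sum, hdual,
      Finset.sum_congr rfl fun q _ => hq q Z X, ← map_sum, ← Finset.sum_mul, hWJ _ (hqA Z)]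

open scoped ComplexOrder in
/-- The general case: the Kraus operators of `p` take values in the support `U` of the fixed
(unnormalized) state `p(1)`, so `p` factors through the operators on `U`, where this state is faithful. -/
theorem nonempty_causalFiniteDecomposition {H : QuantMixed.{u}} {p : H ⟶ H}
    (hp : IsIdempotent p) (hpc : IsCausal p) : Nonempty (CausalFiniteDecomposition p) := by
  obtain ⟨N, V, hV⟩ := exists_eq_sum_conjHom p
  set ρ : H.Op := p.toLinearMap LinearMap.id with hρdef
  have hρV : ρ = ∑ i, V i ∘ₗ (V i).adjoint := by
    rw [hρdef, hV, sum_toLinearMap, LinearMap.sum_apply]; rfl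
  have hρpos : ρ.IsPositive := by
    rw [hρV]
    exact LinearMap.isPositive_sum _ fun i _ => LinearMap.isPositive_self_comp_adjoint (V i)
  have hker (x : H) (hx : inner ℂ (ρ x) x = 0) (i : Fin N) : (V i).adjoint x = 0 := by
    have hnn (i : Fin N) : 0 ≤ inner ℂ ((V i ∘ₗ (V i).adjoint) x) x :=
      (LinearMap.isPositive_self_comp_adjoint (V i)).inner_nonneg_left x
    rw [hρV, LinearMap.sum_apply, sum_inner] at hx
    have h := (Finset.sum_eq_zero_iff_of_nonneg fun i _ => hnn i).1 hx i (Finset.mem_univ i)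
    rw [LinearMap.comp_apply, ← LinearMap.adjoint_inner_right] at h
    exact inner_self_eq_zero.1 h
  have hker' (x : H) (hx : inner ℂ (ρ x) x = 0) : ρ x = 0 := by
    rw [hρV, LinearMap.sum_apply]
    exact Finset.sum_eq_zero fun i _ => by rw [LinearMap.comp_apply, hker x hx, map_zero]
  let U : Submodule ℂ H := LinearMap.range ρ
  -- `Uᗮ = ker ρ` is killed by every `(V i)†`, so `V i` takes values in `Uᗮᗮ = U`.
  have hVU (i : Fin N) (y : H) : V i y ∈ U := by
    rw [← Submodule.orthogonal_orthogonal U]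
    intro x hx
    have h1 : inner ℂ (ρ x) x = 0 := hx _ ⟨x, rfl⟩
    rw [← LinearMap.adjoint_inner_left, hker x h1, inner_zero_left]
  let K : QuantMixed.{u} := ⟨U⟩
  let S : K →ₗ[ℂ] H := U.subtype
  have hSS : S.adjoint ∘ₗ S = LinearMap.id := by
    refine LinearMap.ext fun x => ext_inner_left ℂ fun y => ?_
    rw [LinearMap.comp_apply, LinearMap.adjoint_inner_right]
    rfl
  have hSV (i : Fin N) : (S ∘ₗ S.adjoint) ∘ₗ V i = V i := by
    ext1 y
    have h := LinearMap.congr_fun hSS ⟨V i y, hVU i y⟩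
    exact congrArg Subtype.val h
  let W : H ⟶ K := p ≫ conjHom S.adjoint
  have hSc : IsCausal (conjHom S) := isCausal_conjHom hSS
  have hWS : W ≫ conjHom S = p := by
    change (p ≫ conjHom S.adjoint) ≫ conjHom S = p
    rw [Category.assoc, conjHom_comp, hV, SemiAdditive.sum_comp]
    simp only [conjHom_comp, hSV]
  have hpW : p ≫ W = W := by
    change p ≫ p ≫ conjHom S.adjoint = p ≫ conjHom S.adjoint
    rw [← Category.assoc, hp]
  have hWc : IsCausal W := by
    have h : IsCausal (W ≫ conjHom S) := hWS.symm ▸ hpc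
    rwa [IsCausal, Category.assoc, hSc] at h
  have hid : IsIdempotent (conjHom S ≫ W) := by
    rw [IsIdempotent, Category.assoc, ← Category.assoc W, hWS, hpW]
  have hWρ : W.toLinearMap LinearMap.id = S.adjoint ∘ₗ ρ ∘ₗ S := by
    change (p ≫ conjHom S.adjoint).toLinearMap LinearMap.id = _
    rw [comp_toLinearMap, LinearMap.comp_apply, conjHom_apply, LinearMap.adjoint_adjoint]
  have hpos : (W.toLinearMap LinearMap.id).IsPositive := hWρ ▸ hρpos.adjoint_conj S
  have hfaithful (x : K) (hx : inner ℂ (W.toLinearMap LinearMap.id x) x = 0) : x = 0 := by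
    rw [hWρ, LinearMap.comp_apply, LinearMap.adjoint_inner_left] at hx
    obtain ⟨y, hy⟩ := x.2
    have hx0 : ρ (S x) = 0 := hker' (S x) hx
    have h0 : inner ℂ (S x) (S x) = (0 : ℂ) := by
      have hy' : S x = ρ y := hy.symm
      conv_lhs => rw [hy']
      rw [hρpos.isSymmetric, ← hy', hx0, inner_zero_right]
    exact Subtype.ext (inner_self_eq_zero.1 h0)
  have hfix : (conjHom S ≫ W).toLinearMap (W.toLinearMap LinearMap.id) =
      W.toLinearMap LinearMap.id := by
    rw [← LinearMap.comp_apply, ← comp_toLinearMap, ← Category.assoc, hWS, hpW]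
  obtain ⟨Q, _, D, e, m, h1, h2, h3, h4⟩ :=
    exists_decomposition_of_faithful hid (hSc.comp hWc) hpos hfaithful hfix
  exact nonempty_causalFiniteDecomposition_of_factor hp hWS hSc h1 h2 h3 h4

end QuantMixed

end CausalCat

theorem mainTheorem2 :
    CausalCat.HasFiniteDecompositionProperty CausalCat.QuantMixed.{u} :=
  ⟨CausalCat.QuantMixed.hasCausalDisjointEmbeddings, fun _ _ hp hpc =>
    CausalCat.QuantMixed.nonempty_causalFiniteDecomposition hp hpc⟩
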